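/- **Setting.** Let $S$ be a semigroup with subsemigroups $N$ and $Z$ such that $(S,N,Z)$ is a *structured semigroup*. That is: - $Z\subseteq N$ and $zn=nz$ for all $z\in Z$, $n\in N$; - $Z$ is binormal: if $ab,ba\in Z$ then $aZb\cup bZa\subseteq Z$; - $N$ is $Z$-trinormal: if $n\in N$, $abn=n=nab$ and $ab,ba\in Z$, then $bna\in N$. For $a,s,b\in S$ write $a<_s b$ if $asb=a=bsa$, $as,sa\in N$ and $bs,sb\in Z$. Write $a<b$ if $a<_s b$ for some $s\in S$. For $A\subseteq S$ put $A^{<}=\{b: a<b\text{ for some }a\in A\}$ and $A^{*}=\{s: a<_s b\text{ for some }a\in A,\ b\in S\}$. **Directed cosets.** A *directed coset* is a set $D\subseteq S$ with $DD^*D\subseteq D=D^{<}$ such that for all $a,b\in D$ there is $d\in D$ with $d<a$ and $d<b$. The set $\mathcal D(S)$ of non-empty directed cosets is a groupoid under the inverse $D\mapsto D^*$ and the product $D\cdot E=(DE)^{<}$, which is defined when $(D^*D)^{<}=(EE^*)^{<}$. It carries the topology generated by the sets $\mathcal D_a=\{D\in\mathcal D(S): a\in D\}$, $a\in S$. **Étale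 groupoids and representations.** A groupoid is regarded as its set of arrows, with source $\mathfrak s(g)=g^{-1}g$, range $\mathfrak r(g)=gg^{-1}$, units $G^0=\{g: gg=g\}$, and $gh$ defined iff $\mathfrak s(g)=\mathfrak r(h)$. A groupoid with a topology is *étale* if inverse and product are continuous and $\mathfrak s$ is an open map. A *slice* is a set of arrows on which $\mathfrak s$ and $\mathfrak r$ are injective, and $\mathcal B(G)$ denotes the family of open slices of $G$. An *étale representation* of $(S,N,Z)$ on an étale groupoid $G$ is a map $\theta:S\to\mathcal B(G)$ such that - $\theta(ab)=\theta(a)\theta(b)$ (pointwise product) for all $a,b\in S$; - $\bigcup_{a\in S}\theta(a)=G$; - $\theta(n)\subseteq G^0$ for all $n\in N$; - whenever $g\in\theta(a)$, there is $b<a$ with $g\in\theta(b)$. **Zakrzewski morphisms.** For a relation $\phi\subseteq G\times H$ and $A\subseteq G$ put $\phi^{-1}[A]=\{h\in H: (g,h)\in\phi\text{ for some }g\in A\}$. For étale groupoids $G,H$, a *Zakrzewski morphism* is a relation $\phi\subseteq G\times H$ such that - $(g,h)\in\phi$ implies $(g^{-1},h^{-1})\in\phi$; - if $(g,h),(g',h')\in\phi$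 and $hh'$ is defined, then $gg'$ is defined and $(gg',hh')\in\phi$; - if $h\in H^0$ and $(\mathfrak r(g),h)\in\phi$, there is exactly one $i\in H$ with $\mathfrak r(i)=h$ and $(g,i)\in\phi$; - $\phi^{-1}[O]$ is open in $H$ for every open $O\subseteq G$. **Theorem 11.15.** Let $(S,N,Z)$ be a structured semigroup and assume that $Z$ is symmetric, i.e. $ab\in Z$ implies $baba\in Z$ for all $a,b\in S$. Then $\mathcal D(S)$ is an étale groupoid and the map $\mathcal D: a\mapsto\mathcal D_a$ is a Zakrzewski-universal étale representation of $(S,N,Z)$. That is, $\mathcal D$ is an étale representation on $\mathcal D(S)$, and for every étale groupoid $H$ and every étale representation $\theta:S\to\mathcal B(H)$ there is a unique Zakrzewski morphism $\phi\subseteq\mathcal D(S)\times H$ such that $\theta(a)=\phi^{-1}[\mathcal D_a]$ for all $a\in S$. -/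

import Mathlib

open scoped Pointwise

universe u v

/-! ### Groupoids as sets of arrows -/

/-- A groupoid, presented by its set of arrows: `g h` is defined exactly when the source of `g`
equals the range of `h`, and source and range are `s(g) = g⁻¹g`, `r(g) = gg⁻¹`. -/
class ArrowGroupoid (G : Type u) where
  inv : G → G
  src : G → G
  rng : G → G
  mul : ∀ g h : G, src g = rng h → G
  rng_src : ∀ g, rng (src g) = src g
  src_rng : ∀ g, src (rng g) = rng g
  src_inv : ∀ g, src (inv g) = rng g
  rng_inv : ∀ g, rng (inv g) = src g
  src_mul : ∀ g h (p : src g = rng h), src (mul g h p) = src h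
  rng_mul : ∀ g h (p : src g = rng h), rng (mul g h p) = rng g
  mul_assoc : ∀ g h k (p : src g = rng h) (q : src h = rng k),
    mul (mul g h p) k ((src_mul g h p).trans q) = mul g (mul h k q) (p.trans (rng_mul h k q).symm)
  mul_src : ∀ g, mul g (src g) (rng_src g).symm = g
  rng_mul_self : ∀ g, mul (rng g) g (src_rng g) = g
  inv_mul : ∀ g, mul (inv g) g (src_inv g) = src g
  mul_inv : ∀ g, mul g (inv g) (rng_inv g).symm = rng g

namespace ArrowGroupoid

/-- The units `G⁰ = {g | gg is defined and gg = g}`. -/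
def units (G : Type u) [ArrowGroupoid G] : Set G :=
  {g | ∃ p : src g = rng g, mul g g p = g}

/-- The pointwise product `AB` of two sets of arrows. -/
def setMul {G : Type u} [ArrowGroupoid G] (A B : Set G) : Set G :=
  {k | ∃ a ∈ A, ∃ b ∈ B, ∃ p : src a = rng b, k = mul a b p}

/-- Slices (bisections). -/
def IsSlice {G : Type u} [ArrowGroupoid G] (B : Set G) : Prop :=
  Set.InjOn (src : G → G) B ∧ Set.InjOn (rng : G → G) B

/-- Étale groupoids: inverse and product are continuous and the source map is open. -/
structure IsEtale (G : Type u) [ArrowGroupoid G] [TopologicalSpace G] : Prop where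
  continuous_inv : Continuous (inv : G → G)
  continuous_mul :
    Continuous (fun x : {x : G × G // src x.1 = rng x.2} => mul x.1.1 x.1.2 x.2)
  isOpenMap_src : IsOpenMap (src : G → G)

/-- The preimage `φ⁻¹[A] ⊆ H` of `A ⊆ G` under a relation `φ ⊆ G × H` from `H` to `G`. -/
def relPreimage {G : Type u} {H : Type v} (φ : Set (G × H)) (A : Set G) : Set H :=
  {h | ∃ g ∈ A, (g, h) ∈ φ}

/-- Functorial relations. -/
structure IsFunctorial {G : Type u} {H : Type v} [ArrowGroupoid G] [ArrowGroupoid H]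
    (φ : Set (G × H)) : Prop where
  inv_mem : ∀ g h, (g, h) ∈ φ → (inv g, inv h) ∈ φ
  mul_mem : ∀ g h g' h', (g, h) ∈ φ → (g', h') ∈ φ → ∀ q : src h = rng h',
    ∃ p : src g = rng g', (mul g g' p, mul h h' q) ∈ φ

/-- Zakrzewski morphisms `φ ⊆ G × H`: continuous star-bijective functorial relations. -/
structure IsZakrzewskiMorphism {G : Type u} {H : Type v} [ArrowGroupoid G] [TopologicalSpace G]
    [ArrowGroupoid H] [TopologicalSpace H] (φ : Set (G × H)) : Prop where
  functorial : IsFunctorial φ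
  star_bijective : ∀ (g : G) (h : H), h ∈ units H → (rng g, h) ∈ φ →
    ∃! i : H, rng i = h ∧ (g, i) ∈ φ
  continuous : ∀ O : Set G, IsOpen O → IsOpen (relPreimage φ O)

end ArrowGroupoid

/-! ### Structured semigroups -/

/-- A structured semigroup `(S, N, Z)`: `N` and `Z` are subsemigroups of `S`, `Z` is contained in
the centre of `N` and binormal in `S`, and `N` is `Z`-trinormal. -/
structure StructuredSemigroup (S : Type u) [Semigroup S] where
  N : Subsemigroup S
  Z : Subsemigroup S
  Z_le_N : Z ≤ N
  Z_central : ∀ z ∈ Z, ∀ n ∈ N, z * n = n * z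
  Z_binormal : ∀ a b : S, a * b ∈ Z → b * a ∈ Z →
    ∀ z ∈ Z, a * z * b ∈ Z ∧ b * z * a ∈ Z
  N_trinormal : ∀ a b : S, ∀ n ∈ N, a * b * n = n → n * a * b = n →
    a * b ∈ Z → b * a ∈ Z → b * n * a ∈ N

/-- `Y ⊆ S` is symmetric if `ab ∈ Y` implies `baba ∈ Y`. -/
def IsSymmetricSubset {S : Type u} [Semigroup S] (Y : Set S) : Prop :=
  ∀ a b : S, a * b ∈ Y → b * a * b * a ∈ Y

namespace StructuredSemigroup

variable {S : Type u} [Semigroup S] (T : StructuredSemigroup S)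

/-- `a <ₛ b`: `b` dominates `a` via `s`. -/
structure DomVia (a s b : S) : Prop where
  left : a * s * b = a
  right : b * s * a = a
  as_mem : a * s ∈ T.N
  sa_mem : s * a ∈ T.N
  bs_mem : b * s ∈ T.Z
  sb_mem : s * b ∈ T.Z

/-- The domination relation `a < b`. -/
def Dom (a b : S) : Prop := ∃ s, T.DomVia a s b

/-- The up-closure `A^<`. -/
def up (A : Set S) : Set S := {b | ∃ a ∈ A, T.Dom a b}

/-- The dual `A^*`. -/
def dual (A : Set S) : Set S := {s | ∃ a ∈ A, ∃ b, T.DomVia a s b}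

/-- Cosets: `CC^*C ⊆ C = C^<`. -/
def IsCoset (C : Set S) : Prop := C * T.dual C * C ⊆ C ∧ C = T.up C

/-- Directed (with respect to `<`) subsets. -/
def IsDirected (D : Set S) : Prop := ∀ a ∈ D, ∀ b ∈ D, ∃ d ∈ D, T.Dom d a ∧ T.Dom d b

/-- The non-empty directed cosets `𝒟(S)`. -/
def DirectedCoset : Type u := {D : Set S // T.IsCoset D ∧ D.Nonempty ∧ T.IsDirected D}

variable {T}

/-! #### Facts needed for the groupoid structure on `𝒟(S)` -/

theorem DomVia.of_left {a s b : S} (h1 : a * s * b = a) (h2 : a * s ∈ T.N)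
    (h3 : b * s ∈ T.Z) (h4 : s * b ∈ T.Z) : T.DomVia a s b := by
  have c : b * s * (a * s) = a * s * (b * s) := T.Z_central _ h3 _ h2
  have e1 : b * s * a = a := by
    calc b * s * a = b * s * (a * s * b) := by rw [h1]
      _ = (b * s * (a * s)) * b := by simp only [mul_assoc]
      _ = (a * s * b) * s * b := by rw [c]; simp only [mul_assoc]
      _ = a := by rw [h1, h1]
  have e2 : b * s * (a * s) = a * s := by rw [← mul_assoc, e1]
  have e3 : a * s * b * s = a * s := by rw [h1]
  refine ⟨h1, e1, h2, ?_, h3, h4⟩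
  have := T.N_trinormal b s (a * s) h2 e2 e3 h3 h4
  rwa [show s * (a * s) * b = s * (a * s * b) by simp only [mul_assoc], h1] at this

theorem DomVia.of_right {a s b : S} (h1 : b * s * a = a) (h2 : s * a ∈ T.N)
    (h3 : b * s ∈ T.Z) (h4 : s * b ∈ T.Z) : T.DomVia a s b := by
  have c : s * b * (s * a) = s * a * (s * b) := T.Z_central _ h4 _ h2
  have e1 : a * s * b = a := by
    calc a * s * b = (b * s * a) * s * b := by rw [h1]
      _ = b * (s * a * (s * b)) := by simp only [mul_assoc]
      _ = b * s * (b * s * a) := by rw [← c]; simp only [mul_assoc]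
      _ = a := by rw [h1, h1]
  have e2 : s * a * s * b = s * a := by
    rw [show s * a * s * b = s * (a * s * b) by simp only [mul_assoc], e1]
  have e3 : s * b * (s * a) = s * a := by
    rw [show s * b * (s * a) = s * (b * s * a) by simp only [mul_assoc], h1]
  refine ⟨e1, h1, ?_, h2, h3, h4⟩
  have := T.N_trinormal s b (s * a) h2 e3 e2 h4 h3
  rwa [show b * (s * a) * s = (b * s * a) * s by simp only [mul_assoc], h1] at this

theorem DomVia.trans {a b' b c' c : S} (h : T.DomVia a b' b) (k : T.DomVia b c' c) :
    T.DomVia a c' c := by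
  have e : a * c' = (a * b') * (b * c') := by
    rw [← mul_assoc, h.left]
  refine DomVia.of_left ?_ (e ▸ T.N.mul_mem h.as_mem k.as_mem) k.bs_mem k.sb_mem
  calc a * c' * c = (a * b' * b) * c' * c := by rw [h.left]
    _ = a * b' * (b * c' * c) := by simp only [mul_assoc]
    _ = a := by rw [k.left, h.left]

theorem Dom.trans {a b c : S} (h : T.Dom a b) (k : T.Dom b c) : T.Dom a c := by
  obtain ⟨s, hs⟩ := h
  obtain ⟨t, ht⟩ := k
  exact ⟨t, hs.trans ht⟩

theorem DomVia.switch {a b c' c : S} (h : a * b ∈ T.N) (k : T.DomVia b c' c) :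
    T.DomVia (a * b * c') c c' := by
  have e : a * b * c' * c = a * b := by
    rw [show a * b * c' * c = a * (b * c' * c) by simp only [mul_assoc], k.left]
  exact DomVia.of_left (by rw [e]) (by rwa [e]) k.sb_mem k.bs_mem

theorem DomVia.mul {a b' b c d' d : S} (h : T.DomVia a b' b) (k : T.DomVia c d' d) :
    T.DomVia (a * c) (d' * b') (b * d) := by
  have c1 : b' * b * (c * d') = c * d' * (b' * b) := T.Z_central _ h.sb_mem _ k.as_mem
  have hn : b' * a * (c * d') ∈ T.N := T.N.mul_mem h.sa_mem k.as_mem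
  have e1 : b' * b * (b' * a * (c * d')) = b' * a * (c * d') := by
    rw [show b' * b * (b' * a * (c * d')) = b' * (b * b' * a) * (c * d') by
      simp only [mul_assoc], h.right]
  have e2 : b' * a * (c * d') * b' * b = b' * a * (c * d') := by
    rw [show b' * a * (c * d') * b' * b = b' * a * (c * d' * (b' * b)) by
      simp only [mul_assoc], ← c1,
      show b' * a * (b' * b * (c * d')) = b' * (a * b' * b) * (c * d') by
      simp only [mul_assoc], h.left]
  have m1 := T.N_trinormal b' b _ hn e1 e2 h.sb_mem h.bs_mem
  have e3 : b * (b' * a * (c * d')) * b' = a * c * (d' * b') := by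
    rw [show b * (b' * a * (c * d')) * b' = (b * b' * a) * (c * (d' * b')) by
      simp only [mul_assoc], h.right]
    simp only [mul_assoc]
  refine DomVia.of_left ?_ (e3 ▸ m1) ?_ ?_
  · calc a * c * (d' * b') * (b * d) = a * (c * d' * (b' * b)) * d := by simp only [mul_assoc]
      _ = (a * b' * b) * (c * d' * d) := by rw [← c1]; simp only [mul_assoc]
      _ = a * c := by rw [h.left, k.left]
  · have := (T.Z_binormal b b' h.bs_mem h.sb_mem _ k.bs_mem).1
    simpa only [mul_assoc] using this
  · have := (T.Z_binormal d' d k.sb_mem k.bs_mem _ h.sb_mem).1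
    simpa only [mul_assoc] using this

theorem Dom.mul {a b c d : S} (h : T.Dom a b) (k : T.Dom c d) : T.Dom (a * c) (b * d) := by
  obtain ⟨s, hs⟩ := h
  obtain ⟨t, ht⟩ := k
  exact ⟨_, hs.mul ht⟩

theorem DomVia.smul_left {a b' b n : S} (hn : n ∈ T.N) (h : T.DomVia a b' b) :
    T.DomVia (n * a) b' b := by
  refine DomVia.of_left ?_ ?_ h.bs_mem h.sb_mem
  · rw [show n * a * b' * b = n * (a * b' * b) by simp only [mul_assoc], h.left]
  · rw [mul_assoc]; exact T.N.mul_mem hn h.as_mem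

theorem DomVia.smul_right {a b' b n : S} (hn : n ∈ T.N) (h : T.DomVia a b' b) :
    T.DomVia (a * n) b' b := by
  refine DomVia.of_right ?_ ?_ h.bs_mem h.sb_mem
  · rw [show b * b' * (a * n) = (b * b' * a) * n by simp only [mul_assoc], h.right]
  · rw [← mul_assoc]; exact T.N.mul_mem h.sa_mem hn

theorem up_mono {A B : Set S} (h : A ⊆ B) : T.up A ⊆ T.up B :=
  fun _ ⟨a, ha, k⟩ => ⟨a, h ha, k⟩

theorem dual_mono {A B : Set S} (h : A ⊆ B) : T.dual A ⊆ T.dual B :=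
  fun _ ⟨a, ha, k⟩ => ⟨a, h ha, k⟩

theorem up_up (A : Set S) : T.up (T.up A) ⊆ T.up A :=
  fun _ ⟨_, ⟨a, ha, k⟩, l⟩ => ⟨a, ha, k.trans l⟩

theorem up_mul_up (A B : Set S) : T.up A * T.up B ⊆ T.up (A * B) := by
  rintro _ ⟨x, ⟨a, ha, h⟩, y, ⟨b, hb, k⟩, rfl⟩
  exact ⟨a * b, Set.mul_mem_mul ha hb, h.mul k⟩

theorem dual_mul_dual (A B : Set S) : T.dual A * T.dual B ⊆ T.dual (B * A) := by
  rintro _ ⟨x, ⟨a, ha, a', h⟩, y, ⟨b, hb, b', k⟩, rfl⟩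
  exact ⟨b * a, Set.mul_mem_mul hb ha, _, k.mul h⟩

theorem DomVia.inner {a b' b c' c : S} (h : T.DomVia a b' b) (k : T.DomVia b c' c) :
    T.DomVia a (b' * b * c') (c * b' * b) := by
  have h2 := h.trans k
  refine DomVia.of_left ?_ ?_ ?_ ?_
  · calc a * (b' * b * c') * (c * b' * b)
        = (a * b' * b) * c' * c * (b' * b) := by simp only [mul_assoc]
      _ = a := by rw [h.left, h2.left, ← mul_assoc, h.left]
  · rw [show a * (b' * b * c') = (a * b' * b) * c' by simp only [mul_assoc], h.left]
    exact h2.as_mem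
  · have := (T.Z_binormal c c' k.bs_mem k.sb_mem _ (T.Z.mul_mem h.sb_mem h.sb_mem)).1
    simpa only [mul_assoc] using this
  · have := T.Z.mul_mem (T.Z.mul_mem h.sb_mem k.sb_mem) h.sb_mem
    simpa only [mul_assoc] using this

theorem dual_up (A : Set S) : T.dual (T.up A) ⊆ T.up (T.dual A) := by
  rintro c' ⟨b, ⟨a, ha, b', h⟩, c, k⟩
  exact ⟨b' * b * c', ⟨a, ha, _, h.inner k⟩, c, DomVia.switch (T.Z_le_N h.sb_mem) k⟩

theorem up_up_subset_dual_dual (A : Set S) : T.up (T.up A) ⊆ T.dual (T.dual A) := by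
  rintro c ⟨b, ⟨a, ha, b', h⟩, c', k⟩
  exact ⟨b' * b * c', ⟨a, ha, _, h.inner k⟩, c', DomVia.switch (T.Z_le_N h.sb_mem) k⟩

theorem triple_dual {A : Set S} (hA : A * T.dual A * A ⊆ A) :
    T.dual A * T.dual (T.dual A) * T.dual A ⊆ T.dual A := by
  refine (Set.mul_subset_mul_right (dual_mul_dual _ _)).trans ((dual_mul_dual _ _).trans ?_)
  rw [← mul_assoc]
  exact dual_mono hA

theorem triple_aux {A : Set S} (hA : A * T.dual A * A ⊆ A) {a a' b b' c : S} (hc : c ∈ A)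
    (h : T.DomVia c b' b) (k : T.DomVia b' a a') :
    ∃ x ∈ A, T.Dom x (a * b' * b) ∧ T.DomVia (a * b' * b) a' a := by
  have hb : b' ∈ T.dual A := ⟨c, hc, b, h⟩
  have ha : a ∈ T.dual (T.dual A) := ⟨b', hb, a', k⟩
  refine ⟨c * b' * (a * b' * c), ?_, ⟨b' * b * a', ?_⟩, ?_⟩
  · have h1 : b' * a * b' ∈ T.dual A :=
      triple_dual hA (Set.mul_mem_mul (Set.mul_mem_mul hb ha) hb)
    have := hA (Set.mul_mem_mul (Set.mul_mem_mul hc h1) hc)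
    simpa only [mul_assoc] using this
  · refine DomVia.smul_left h.as_mem (DomVia.of_right ?_ ?_ ?_ ?_)
    · calc a * b' * b * (b' * b * a') * (a * b' * c)
          = a * b' * (b * b' * (b * (a' * a * b') * c)) := by simp only [mul_assoc]
        _ = a * b' * c := by rw [k.right, h.right, h.right]
    · rw [show b' * b * a' * (a * b' * c) = b' * (b * (a' * a * b') * c) by
        simp only [mul_assoc], k.right, h.right]
      exact h.sa_mem
    · have := (T.Z_binormal a a' k.sb_mem k.bs_mem _ (T.Z.mul_mem h.sb_mem h.sb_mem)).1
      simpa only [mul_assoc] using this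
    · have := T.Z.mul_mem (T.Z.mul_mem h.sb_mem k.bs_mem) h.sb_mem
      simpa only [mul_assoc] using this
  · refine DomVia.of_right ?_ ?_ k.sb_mem k.bs_mem
    · rw [show a * a' * (a * b' * b) = a * (a' * a * b') * b by simp only [mul_assoc], k.right]
    · rw [show a' * (a * b' * b) = (a' * a * b') * b by simp only [mul_assoc], k.right]
      exact T.Z_le_N h.sb_mem

theorem up_dual {A : Set S} (hA : A * T.dual A * A ⊆ A) : T.up (T.dual A) ⊆ T.dual A := by
  rintro a' ⟨b', ⟨c, hc, b, h⟩, a, k⟩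
  obtain ⟨x, hx, ⟨t, ht⟩, hk⟩ := triple_aux hA hc h k
  exact ⟨x, hx, a, ht.trans hk⟩

theorem dual_dual {A : Set S} (hA : A * T.dual A * A ⊆ A) :
    T.dual (T.dual A) = T.up (T.up A) := by
  refine Set.Subset.antisymm ?_ (up_up_subset_dual_dual A)
  rintro a ⟨b', ⟨c, hc, b, h⟩, a', k⟩
  obtain ⟨x, hx, h1, h2⟩ := triple_aux hA hc h k
  exact ⟨_, ⟨x, hx, h1⟩, a', h2⟩

theorem IsDirected.round {D : Set S} (hD : T.IsDirected D) : D ⊆ T.up D := by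
  intro a ha
  obtain ⟨d, hd, h, -⟩ := hD a ha a ha
  exact ⟨d, hd, h⟩

theorem IsDirected.dual {D : Set S} (hD : T.IsDirected D) : T.IsDirected (T.dual D) := by
  rintro b' ⟨a, ha, b, hb⟩ d' ⟨c, hc, d, hd⟩
  obtain ⟨f, hf, ⟨s, hs⟩, ⟨t, ht⟩⟩ := hD a ha c hc
  obtain ⟨e, he, ⟨f', hf'⟩, -⟩ := hD f hf f hf
  have fb := hs.trans hb
  have fd := ht.trans hd
  have eb := hf'.trans fb
  refine ⟨b' * f * d', ⟨e, he, d * f' * b, ?_⟩, ⟨b, ?_⟩, ⟨d, DomVia.switch fb.sa_mem fd⟩⟩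
  · have c1 : f * f' * (e * b') = e * b' * (f * f') := T.Z_central _ hf'.bs_mem _ eb.as_mem
    refine DomVia.of_left ?_ ?_ ?_ ?_
    · calc e * (b' * f * d') * (d * f' * b)
          = e * b' * (f * d' * d) * f' * b := by simp only [mul_assoc]
        _ = e * b' * (f * f') * b := by rw [fd.left]; simp only [mul_assoc]
        _ = f * f' * (e * b' * b) := by rw [← c1]; simp only [mul_assoc]
        _ = e := by rw [eb.left, hf'.right]
    · have := T.N.mul_mem eb.as_mem fd.as_mem
      simpa only [mul_assoc] using this
    · have z1 := (T.Z_binormal f f' hf'.bs_mem hf'.sb_mem _ fb.bs_mem).2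
      have := (T.Z_binormal d d' fd.bs_mem fd.sb_mem _ z1).1
      simpa only [mul_assoc] using this
    · have z1 := (T.Z_binormal f f' hf'.bs_mem hf'.sb_mem _ fd.sb_mem).1
      have := (T.Z_binormal b b' fb.bs_mem fb.sb_mem _ z1).2
      simpa only [mul_assoc] using this
  · have e1 : b * (b' * f * d') = f * d' := by
      rw [show b * (b' * f * d') = (b * b' * f) * d' by simp only [mul_assoc], fb.right]
    refine DomVia.of_right ?_ (e1 ▸ fd.as_mem) fb.sb_mem fb.bs_mem
    rw [mul_assoc b' b, e1, mul_assoc]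

theorem IsDirected.up {D : Set S} (hD : T.IsDirected D) : T.IsDirected (T.up D) := by
  rintro a ⟨x, hx, hxa⟩ b ⟨y, hy, hyb⟩
  obtain ⟨z, hz, h1, h2⟩ := hD x hx y hy
  exact ⟨z, hD.round hz, h1.trans hxa, h2.trans hyb⟩

theorem IsDirected.mul {D E : Set S} (hD : T.IsDirected D) (hE : T.IsDirected E) :
    T.IsDirected (D * E) := by
  rintro _ ⟨a, ha, b, hb, rfl⟩ _ ⟨c, hc, d, hd, rfl⟩
  obtain ⟨x, hx, h1, h2⟩ := hD a ha c hc
  obtain ⟨y, hy, h3, h4⟩ := hE b hb d hd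
  exact ⟨x * y, Set.mul_mem_mul hx hy, h1.mul h3, h2.mul h4⟩

theorem IsDirected.dual_nonempty {D : Set S} (hD : T.IsDirected D) (hne : D.Nonempty) :
    (T.dual D).Nonempty := by
  obtain ⟨a, ha⟩ := hne
  obtain ⟨d, hd, ⟨s, hs⟩, -⟩ := hD a ha a ha
  exact ⟨s, d, hd, a, hs⟩

/-- The up-closure of a directed triple-product-closed set is a directed coset. -/
theorem isCoset_up {A : Set S} (hA : A * T.dual A * A ⊆ A) (hD : T.IsDirected A) :
    T.IsCoset (T.up A) := by
  refine ⟨?_, Set.Subset.antisymm hD.up.round (up_up A)⟩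
  have e : T.up A = T.dual (T.dual A) := by
    rw [dual_dual hA]
    exact Set.Subset.antisymm hD.up.round (up_up A)
  rw [e]
  exact triple_dual (triple_dual hA)

namespace DirectedCoset

theorem coset (D : T.DirectedCoset) : T.IsCoset D.1 := D.2.1

theorem directed (D : T.DirectedCoset) : T.IsDirected D.1 := D.2.2.2

theorem up_eq (D : T.DirectedCoset) : T.up D.1 = D.1 := D.2.1.2.symm

theorem triple (D : T.DirectedCoset) : D.1 * T.dual D.1 * D.1 ⊆ D.1 := D.2.1.1

/-- The inverse `D ↦ D^*`. -/
def inv (D : T.DirectedCoset) : T.DirectedCoset :=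
  ⟨T.dual D.1, ⟨triple_dual D.triple,
    Set.Subset.antisymm D.directed.dual.round (up_dual D.triple)⟩,
    D.directed.dual_nonempty D.2.2.1, D.directed.dual⟩

theorem inv_inv (D : T.DirectedCoset) : D.inv.inv = D := by
  apply Subtype.ext
  change T.dual (T.dual D.1) = D.1
  rw [dual_dual D.triple, D.up_eq, D.up_eq]

theorem dual_mul_mul_subset {D E : T.DirectedCoset}
    (h : T.dual D.1 * D.1 ⊆ T.up (E.1 * T.dual E.1)) :
    T.dual (D.1 * E.1) * D.1 ⊆ T.dual E.1 := by
  have h1 : T.dual D.1 * D.1 * E.1 ⊆ E.1 := by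
    have h2 : T.dual D.1 * D.1 * E.1 ⊆ T.up (E.1 * T.dual E.1) * T.up E.1 :=
      Set.mul_subset_mul h E.up_eq.ge
    exact h2.trans ((up_mul_up _ _).trans ((up_mono E.triple).trans E.up_eq.le))
  have h3 : D.1 = T.dual (T.dual D.1) := (congrArg Subtype.val D.inv_inv).symm
  calc T.dual (D.1 * E.1) * D.1 = T.dual (D.1 * E.1) * T.dual (T.dual D.1) := by rw [← h3]
    _ ⊆ T.dual (T.dual D.1 * (D.1 * E.1)) := dual_mul_dual _ _
    _ ⊆ T.dual E.1 := dual_mono (by rwa [← mul_assoc])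

/-- The product `D · E = (DE)^<`, for suitable `D` and `E`. -/
def prod (D E : T.DirectedCoset) (h : T.dual D.1 * D.1 ⊆ T.up (E.1 * T.dual E.1)) :
    T.DirectedCoset :=
  ⟨T.up (D.1 * E.1), isCoset_up (by
      calc D.1 * E.1 * T.dual (D.1 * E.1) * (D.1 * E.1)
          = D.1 * (E.1 * (T.dual (D.1 * E.1) * D.1) * E.1) := by simp only [mul_assoc]
        _ ⊆ D.1 * (E.1 * T.dual E.1 * E.1) := Set.mul_subset_mul_left
            (Set.mul_subset_mul_right (Set.mul_subset_mul_left (dual_mul_mul_subset h)))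
        _ ⊆ D.1 * E.1 := Set.mul_subset_mul_left E.triple) (D.directed.mul E.directed),
    (D.2.2.1.mul E.2.2.1).mono (D.directed.mul E.directed).round,
    (D.directed.mul E.directed).up⟩

/-- The source `s(D) = (D^*D)^<`. -/
def src (D : T.DirectedCoset) : T.DirectedCoset :=
  prod D.inv D (by
    have h : T.dual D.inv.1 = D.1 := congrArg Subtype.val D.inv_inv
    rw [h]
    exact (D.directed.mul D.directed.dual).round)

/-- The range `r(D) = (DD^*)^<`. -/
def rng (D : T.DirectedCoset) : T.DirectedCoset :=
  prod D D.inv (by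
    have h : T.dual D.inv.1 = D.1 := congrArg Subtype.val D.inv_inv
    rw [h]
    exact (D.directed.dual.mul D.directed).round)

theorem src_val (D : T.DirectedCoset) : D.src.1 = T.up (T.dual D.1 * D.1) := rfl

theorem rng_val (D : T.DirectedCoset) : D.rng.1 = T.up (D.1 * T.dual D.1) := rfl

theorem src_inv (D : T.DirectedCoset) : D.inv.src = D.rng := by
  apply Subtype.ext
  change T.up (D.inv.inv.1 * T.dual D.1) = _
  rw [inv_inv]; rfl

theorem rng_inv (D : T.DirectedCoset) : D.inv.rng = D.src := by
  apply Subtype.ext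
  change T.up (T.dual D.1 * D.inv.inv.1) = _
  rw [inv_inv]; rfl

theorem composable {D E : T.DirectedCoset} (p : D.src = E.rng) :
    T.dual D.1 * D.1 ⊆ T.up (E.1 * T.dual E.1) := by
  rw [← rng_val, ← p]
  exact (D.directed.dual.mul D.directed).round

/-- The groupoid product, defined when `s(D) = r(E)`. -/
def mul (D E : T.DirectedCoset) (p : D.src = E.rng) : T.DirectedCoset := prod D E (composable p)

theorem mul_val (D E : T.DirectedCoset) (p : D.src = E.rng) :
    (mul D E p).1 = T.up (D.1 * E.1) := rfl

theorem subset_up_triple (D : T.DirectedCoset) : D.1 ⊆ T.up (D.1 * T.dual D.1 * D.1) := by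
  intro d hd
  obtain ⟨e, he, ⟨s, hs⟩, -⟩ := D.directed d hd d hd
  refine ⟨e, ?_, s, hs⟩
  rw [← hs.left]
  exact Set.mul_mem_mul (Set.mul_mem_mul he ⟨e, he, d, hs⟩) hd

theorem src_mul (D E : T.DirectedCoset) (p : D.src = E.rng) : (mul D E p).src = E.src := by
  apply Subtype.ext
  rw [src_val, src_val, mul_val]
  have hr : D.1 * E.1 ⊆ T.up (D.1 * E.1) := (D.directed.mul E.directed).round
  apply Set.Subset.antisymm
  · refine (up_mono ((Set.mul_subset_mul_right (dual_up _)).trans (up_mul_up _ _))).trans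
      ((up_up _).trans (up_mono ?_))
    rw [← mul_assoc]
    exact Set.mul_subset_mul_right (dual_mul_mul_subset (composable p))
  · have h0 : E.1 * T.dual E.1 ⊆ T.up (T.dual D.1 * D.1) := by
      rw [← src_val, p]
      exact (E.directed.mul E.directed.dual).round
    have h3 : T.dual (T.dual E.1) = E.1 := congrArg Subtype.val E.inv_inv
    have h1 : T.dual E.1 ⊆ T.up (T.dual (D.1 * E.1) * D.1) := by
      calc T.dual E.1 ⊆ T.up (T.dual E.1 * T.dual (T.dual E.1) * T.dual E.1) :=
            E.inv.subset_up_triple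
        _ = T.up (T.dual E.1 * (E.1 * T.dual E.1)) := by rw [h3, mul_assoc]
        _ ⊆ T.up (T.up (T.dual E.1) * T.up (T.dual D.1 * D.1)) :=
            up_mono (Set.mul_subset_mul E.directed.dual.round h0)
        _ ⊆ T.up (T.dual E.1 * (T.dual D.1 * D.1)) := (up_mono (up_mul_up _ _)).trans (up_up _)
        _ ⊆ T.up (T.dual (D.1 * E.1) * D.1) := by
            rw [← mul_assoc]
            exact up_mono (Set.mul_subset_mul_right (dual_mul_dual _ _))
    refine (up_mono ((Set.mul_subset_mul h1 E.up_eq.ge).trans (up_mul_up _ _))).trans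
      ((up_up _).trans (up_mono ?_))
    rw [mul_assoc]
    exact Set.mul_subset_mul (dual_mono hr) hr

theorem rng_mul (D E : T.DirectedCoset) (p : D.src = E.rng) : (mul D E p).rng = D.rng := by
  apply Subtype.ext
  rw [rng_val, rng_val, mul_val]
  have hr : D.1 * E.1 ⊆ T.up (D.1 * E.1) := (D.directed.mul E.directed).round
  have h0 : E.1 * T.dual E.1 ⊆ T.up (T.dual D.1 * D.1) := by
    rw [← src_val, p]
    exact (E.directed.mul E.directed.dual).round
  have h3 : T.dual (T.dual E.1) = E.1 := congrArg Subtype.val E.inv_inv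
  apply Set.Subset.antisymm
  · have h1 : D.1 * (E.1 * T.dual E.1) ⊆ D.1 := by
      have h2 : D.1 * (E.1 * T.dual E.1) ⊆ T.up D.1 * T.up (T.dual D.1 * D.1) :=
        Set.mul_subset_mul D.up_eq.ge h0
      refine h2.trans ((up_mul_up _ _).trans ?_)
      rw [← mul_assoc]
      exact (up_mono D.triple).trans D.up_eq.le
    have h4 : E.1 * T.dual (D.1 * E.1) ⊆ T.dual D.1 := by
      calc E.1 * T.dual (D.1 * E.1) = T.dual (T.dual E.1) * T.dual (D.1 * E.1) := by rw [h3]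
        _ ⊆ T.dual (D.1 * E.1 * T.dual E.1) := dual_mul_dual _ _
        _ ⊆ T.dual D.1 := dual_mono (by rwa [mul_assoc])
    refine (up_mono ((Set.mul_subset_mul_left (dual_up _)).trans (up_mul_up _ _))).trans
      ((up_up _).trans (up_mono ?_))
    rw [mul_assoc]
    exact Set.mul_subset_mul_left h4
  · have h1 : D.1 ⊆ T.up (D.1 * E.1 * T.dual E.1) := by
      calc D.1 ⊆ T.up (D.1 * T.dual D.1 * D.1) := D.subset_up_triple
        _ ⊆ T.up (T.up D.1 * T.up (E.1 * T.dual E.1)) := by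
            rw [mul_assoc]
            exact up_mono (Set.mul_subset_mul D.up_eq.ge (composable p))
        _ ⊆ T.up (D.1 * (E.1 * T.dual E.1)) := (up_mono (up_mul_up _ _)).trans (up_up _)
        _ = T.up (D.1 * E.1 * T.dual E.1) := by rw [mul_assoc]
    refine (up_mono ((Set.mul_subset_mul h1 D.directed.dual.round).trans
      (up_mul_up _ _))).trans ((up_up _).trans (up_mono ?_))
    rw [mul_assoc]
    exact Set.mul_subset_mul hr ((dual_mul_dual _ _).trans (dual_mono hr))

theorem rng_src (D : T.DirectedCoset) : D.src.rng = D.src := by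
  have h := rng_mul D.inv D D.src_inv
  rw [rng_inv] at h
  exact h

theorem src_rng (D : T.DirectedCoset) : D.rng.src = D.rng := by
  have h := src_mul D D.inv D.rng_inv.symm
  rw [src_inv] at h
  exact h

/-- The groupoid `𝒟(S)` of non-empty directed cosets: the inverse is `D ↦ D^*` and the product is
`D · E = (DE)^<`, defined when `s(D) = (D^*D)^<` equals `r(E) = (EE^*)^<`. -/
instance : ArrowGroupoid T.DirectedCoset where
  inv := inv
  src := src
  rng := rng
  mul := mul
  rng_src := rng_src
  src_rng := src_rng
  src_inv := src_inv
  rng_inv := rng_inv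
  src_mul := src_mul
  rng_mul := rng_mul
  mul_assoc D E F p q := by
    apply Subtype.ext
    simp only [mul_val]
    apply Set.Subset.antisymm
    · refine (up_mono ((Set.mul_subset_mul_left F.up_eq.ge).trans (up_mul_up _ _))).trans
        ((up_up _).trans (up_mono ?_))
      rw [mul_assoc]
      exact Set.mul_subset_mul_left (E.directed.mul F.directed).round
    · refine (up_mono ((Set.mul_subset_mul_right D.up_eq.ge).trans (up_mul_up _ _))).trans
        ((up_up _).trans (up_mono ?_))
      rw [← mul_assoc]
      exact Set.mul_subset_mul_right (D.directed.mul E.directed).round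
  mul_src D := by
    apply Subtype.ext
    rw [mul_val, src_val]
    apply Set.Subset.antisymm
    · refine (up_mono ((Set.mul_subset_mul_right D.up_eq.ge).trans (up_mul_up _ _))).trans
        ((up_up _).trans ((up_mono ?_).trans D.up_eq.le))
      rw [← mul_assoc]
      exact D.triple
    · refine D.subset_up_triple.trans (up_mono ?_)
      rw [mul_assoc]
      exact Set.mul_subset_mul_left (D.directed.dual.mul D.directed).round
  rng_mul_self D := by
    apply Subtype.ext
    rw [mul_val, rng_val]
    apply Set.Subset.antisymm
    · refine (up_mono ((Set.mul_subset_mul_left D.up_eq.ge).trans (up_mul_up _ _))).trans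
        ((up_up _).trans ((up_mono ?_).trans D.up_eq.le))
      exact D.triple
    · refine D.subset_up_triple.trans (up_mono ?_)
      exact Set.mul_subset_mul_right (D.directed.mul D.directed.dual).round
  inv_mul _ := rfl
  mul_inv _ := rfl

end DirectedCoset

variable (T)

/-- The directed coset representation `a ↦ 𝒟_a = {D ∈ 𝒟(S) : a ∈ D}`. -/
def directedCosetRep (a : S) : Set T.DirectedCoset := {D | a ∈ D.1}

/-- The canonical topology on `𝒟(S)`, generated by the sets `𝒟_a`. -/
instance : TopologicalSpace T.DirectedCoset :=
  TopologicalSpace.generateFrom (Set.range T.directedCosetRep)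

/-! ### Étale representations and universality -/

/-- `θ : S → ℬ(G)` is an étale representation of `(S, N, Z)` on the étale groupoid `G`: a semigroup
homomorphism into the open slices of `G` whose values cover `G`, which maps `N` to open sets of
units and which is locally round. -/
structure IsEtaleRepresentation {G : Type v} [ArrowGroupoid G] [TopologicalSpace G]
    (θ : S → Set G) : Prop where
  etale : ArrowGroupoid.IsEtale G
  isOpen : ∀ a, IsOpen (θ a)
  isSlice : ∀ a, ArrowGroupoid.IsSlice (θ a)
  map_mul : ∀ a b, θ (a * b) = ArrowGroupoid.setMul (θ a) (θ b)
  covers : ∀ g, ∃ a, g ∈ θ a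
  map_N : ∀ n ∈ T.N, θ n ⊆ ArrowGroupoid.units G
  locally_round : ∀ g a, g ∈ θ a → ∃ b, T.Dom b a ∧ g ∈ θ b

/-- `μ : S → ℬ(G)` is a Zakrzewski-universal étale representation: it is an étale representation,
and every étale representation `θ : S → ℬ(H)` on an étale groupoid `H` (in any
universe `v`) is `a ↦ φ⁻¹[μ(a)]` for a unique Zakrzewski morphism `φ ⊆ G × H`. -/
structure IsZakrzewskiUniversal {G : Type u} [ArrowGroupoid G] [TopologicalSpace G]
    (μ : S → Set G) : Prop where
  isEtaleRepresentation : T.IsEtaleRepresentation μ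
  existsUnique : ∀ (H : Type v) [ArrowGroupoid H] [TopologicalSpace H] (θ : S → Set H),
    T.IsEtaleRepresentation θ →
      ∃! φ : Set (G × H), ArrowGroupoid.IsZakrzewskiMorphism φ ∧
        ∀ a, θ a = ArrowGroupoid.relPreimage φ (μ a)

end StructuredSemigroup

/-! A directed coset `D` is recovered from any `a ∈ D` together with its source or its range: `D =
(a·s(D))^< = (r(D)·a)^<` (`eq_up_mul_src`, `eq_up_rng_mul`). Hence each `𝒟_a` is a slice.
Conversely, if `b <ₛ a`, every coset `E` containing `sb` is a unit and is the source of the coset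
`(aE)^<`, which contains `a` (`exists_src_eq`). This one construction gives openness of the source
map, the factorisation behind `𝒟_{ab} ⊆ 𝒟_a𝒟_b`, and the cosets needed for the universal morphism.
Symmetry of `Z` enters only in that factorisation: if `c <ₜ ab`, then `btc < b` and `cta < a`.

For universality, let `θ_h` be the set of `a` with `h ∈ θ(a)`. These fibres are up-closed, and they
respect products and duals because `θ` sends `N` to units. For a unit `u`, the part `θ_u ∩ N` is
directed, so `V_u = (θ_u ∩ N)^<` is a unit coset, and it is the largest one inside `θ_u`. The
morphism relates `D` to `h` when `D ⊆ θ_h`, `s(D) = V_{s(h)}` and `r(D) = V_{r(h)}`. For `D ⊆ θ_h`,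
either of the last two equalities implies the other, by maximality of `V_u`.

For uniqueness, any Zakrzewski morphism inducing `θ` can relate a unit `u` to no unit coset other
than `V_u`. It therefore lies inside the morphism above, and since a coset is determined by one
element and its source, the two coincide. -/

namespace ArrowGroupoid

/-! ### Units of an arrow groupoid. -/

variable {G : Type u} [ArrowGroupoid G]

theorem src_src (g : G) : src (src g) = src g := by
  have h := src_rng (src g)
  rwa [rng_src] at h

theorem rng_rng (g : G) : rng (rng g) = rng g := by
  have h := rng_src (rng g)
  rwa [src_rng] at h

theorem mul_eq_left {g h : G} (p : src g = rng h) (hh : rng h = h) : mul g h p = g := by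
  have e : h = src g := hh.symm.trans p.symm
  subst e
  exact mul_src g

theorem mul_eq_right {g h : G} (p : src g = rng h) (hg : src g = g) : mul g h p = h := by
  have e : g = rng h := hg.symm.trans p
  subst e
  exact rng_mul_self h

theorem src_of_mem_units {g : G} (hg : g ∈ units G) : src g = g := by
  obtain ⟨p, e⟩ := hg
  have h1 := mul_assoc (inv g) g g (src_inv g) p
  have h2 : mul (mul (inv g) g (src_inv g)) g ((src_mul _ _ _).trans p) = g :=
    mul_eq_right _ (by rw [inv_mul, src_src])
  rw [h2] at h1
  simp only [e, inv_mul] at h1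
  exact h1.symm

theorem rng_of_mem_units {g : G} (hg : g ∈ units G) : rng g = g := by
  rw [← hg.1, src_of_mem_units hg]

theorem mem_units_of_src {g : G} (h : src g = g) : g ∈ units G := by
  have p : src g = rng g := by
    have := rng_src g
    rw [h] at this
    rw [h, this]
  exact ⟨p, mul_eq_right p h⟩

theorem src_mem_units (g : G) : src g ∈ units G := mem_units_of_src (src_src g)

theorem rng_mem_units (g : G) : rng g ∈ units G := mem_units_of_src (src_rng g)

theorem eq_inv_of_mul_mem_units {g h : G} (p : src g = rng h) (hm : mul g h p ∈ units G) :
    g = inv h := by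
  have h1 := mul_assoc g h (inv h) p (rng_inv h).symm
  rw [mul_eq_right _ (src_of_mem_units hm)] at h1
  rw [h1]
  exact (mul_eq_left _ (by rw [mul_inv, rng_rng])).symm

end ArrowGroupoid

namespace StructuredSemigroup

/-! ### More on domination, and directed cosets with prescribed source or range. -/

variable {S : Type u} [Semigroup S] {T : StructuredSemigroup S}

theorem DomVia.mul_mem_N {a s b : S} (h : T.DomVia a s b) (hb : b ∈ T.N) : a ∈ T.N := by
  rw [← h.left]
  exact T.N.mul_mem h.as_mem hb

theorem Dom.mem_N {a b : S} (h : T.Dom a b) (hb : b ∈ T.N) : a ∈ T.N := by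
  obtain ⟨s, hs⟩ := h
  exact hs.mul_mem_N hb

/-- If `a <ₛ b` then `sas` is dominated by `s` via `b`. -/
theorem DomVia.reverse {a s b : S} (h : T.DomVia a s b) : T.DomVia (s * a * s) b s :=
  DomVia.switch h.sa_mem h

theorem DomVia.mul_reverse {a s b : S} (h : T.DomVia a s b) : b * (s * a * s) = a * s := by
  rw [show b * (s * a * s) = (b * s * a) * s by simp only [mul_assoc], h.right]

/-- Left multiplication by `a` preserves domination below the source of `a`. -/
theorem DomVia.mul_left_of_fix {a s w t x : S} (has : a * s ∈ T.Z) (hsa : s * a ∈ T.Z)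
    (hw : s * a * w = w) (h : T.DomVia w t x) : T.DomVia (a * w) (t * s) (a * x) := by
  have c : s * a * (w * t) = w * t * (s * a) := T.Z_central _ hsa _ h.as_mem
  have e : s * a * (w * t) = w * t := by rw [← mul_assoc, hw]
  refine DomVia.of_left ?_ ?_ ?_ ?_
  · calc a * w * (t * s) * (a * x) = a * (w * t * (s * a)) * x := by simp only [mul_assoc]
      _ = a * (w * t * x) := by rw [← c, e]; simp only [mul_assoc]
      _ = a * w := by rw [h.left]
  · have := T.N_trinormal s a (w * t) h.as_mem e
      (by rw [mul_assoc (w * t) s a, ← c, e]) hsa has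
    simpa only [mul_assoc] using this
  · have := (T.Z_binormal a s has hsa _ h.bs_mem).1
    simpa only [mul_assoc] using this
  · have := (T.Z_binormal t x h.sb_mem h.bs_mem _ hsa).1
    simpa only [mul_assoc] using this

namespace DirectedCoset

theorem mem_of_dom (D : T.DirectedCoset) {a b : S} (ha : a ∈ D.1) (h : T.Dom a b) : b ∈ D.1 := by
  rw [← D.up_eq]
  exact ⟨a, ha, h⟩

theorem exists_domVia (D : T.DirectedCoset) {a : S} (ha : a ∈ D.1) :
    ∃ b ∈ D.1, ∃ s ∈ T.dual D.1, T.DomVia b s a := by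
  obtain ⟨b, hb, ⟨s, hs⟩, -⟩ := D.directed a ha a ha
  exact ⟨b, hb, s, ⟨b, hb, a, hs⟩, hs⟩

theorem dual_mul_subset_src (D : T.DirectedCoset) : T.dual D.1 * D.1 ⊆ D.src.1 :=
  (D.directed.dual.mul D.directed).round

theorem mul_dual_subset_rng (D : T.DirectedCoset) : D.1 * T.dual D.1 ⊆ D.rng.1 :=
  (D.directed.mul D.directed.dual).round

theorem mul_src_subset (D : T.DirectedCoset) : D.1 * D.src.1 ⊆ D.1 := by
  rw [src_val]
  refine (Set.mul_subset_mul_right D.up_eq.ge).trans ((up_mul_up _ _).trans ?_)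
  rw [← mul_assoc]
  exact (up_mono D.triple).trans D.up_eq.le

theorem rng_mul_subset (D : T.DirectedCoset) : D.rng.1 * D.1 ⊆ D.1 := by
  rw [rng_val]
  refine (Set.mul_subset_mul_left D.up_eq.ge).trans ((up_mul_up _ _).trans ?_)
  exact (up_mono D.triple).trans D.up_eq.le

/-- Below `d` and `a` there is `e ∈ D`; if `e <ₜ a` then `e = a(te)` with `te ∈ D^*D`. -/
theorem eq_up_mul_src (D : T.DirectedCoset) {a : S} (ha : a ∈ D.1) :
    D.1 = T.up ({a} * D.src.1) := by
  apply Set.Subset.antisymm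
  · intro d hd
    obtain ⟨e, he, hed, ⟨t, ht⟩⟩ := D.directed d hd a ha
    refine ⟨e, ⟨a, rfl, t * e, D.dual_mul_subset_src ⟨t, ⟨e, he, a, ht⟩, e, he, rfl⟩, ?_⟩, hed⟩
    change a * (t * e) = e
    rw [← mul_assoc, ht.right]
  · refine (up_mono ?_).trans D.up_eq.le
    exact (Set.mul_subset_mul_right (Set.singleton_subset_iff.2 ha)).trans D.mul_src_subset

theorem eq_up_rng_mul (D : T.DirectedCoset) {a : S} (ha : a ∈ D.1) :
    D.1 = T.up (D.rng.1 * {a}) := by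
  apply Set.Subset.antisymm
  · intro d hd
    obtain ⟨e, he, hed, ⟨t, ht⟩⟩ := D.directed d hd a ha
    exact ⟨e, ⟨e * t, D.mul_dual_subset_rng ⟨e, he, t, ⟨e, he, a, ht⟩, rfl⟩, a, rfl, ht.left⟩, hed⟩
  · refine (up_mono ?_).trans D.up_eq.le
    exact (Set.mul_subset_mul_left (Set.singleton_subset_iff.2 ha)).trans D.rng_mul_subset

theorem eq_of_src_eq {D E : T.DirectedCoset} {a : S} (hD : a ∈ D.1) (hE : a ∈ E.1)
    (h : D.src = E.src) : D = E := by
  apply Subtype.ext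
  rw [D.eq_up_mul_src hD, E.eq_up_mul_src hE, h]

theorem eq_of_rng_eq {D E : T.DirectedCoset} {a : S} (hD : a ∈ D.1) (hE : a ∈ E.1)
    (h : D.rng = E.rng) : D = E := by
  apply Subtype.ext
  rw [D.eq_up_rng_mul hD, E.eq_up_rng_mul hE, h]

theorem src_src (D : T.DirectedCoset) : D.src.src = D.src := ArrowGroupoid.src_src D

/-- If `m <ₛ n` in `D`, then `sn ∈ Z` dominates both `m` and `sm` via itself, so `D` and `s(D)`
share the element `sn`. They also share their source, hence coincide. -/
theorem src_eq_of_mem_N (D : T.DirectedCoset) {n : S} (hn : n ∈ T.N) (hD : n ∈ D.1) :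
    D.src = D := by
  obtain ⟨m, hm, s, hs, h⟩ := D.exists_domVia hD
  have hZ : s * n * (s * n) ∈ T.Z := T.Z.mul_mem h.sb_mem h.sb_mem
  have e : m * (s * n) = m := by rw [← mul_assoc, h.left]
  have e' : s * m * (s * n) = s * m := by rw [mul_assoc, e]
  have h1 : s * n ∈ D.1 := D.mem_of_dom hm ⟨s * n, DomVia.of_left (by rw [e, e])
    (by rw [e]; exact h.mul_mem_N hn) hZ hZ⟩
  have h2 : s * n ∈ D.src.1 := ⟨s * m, ⟨s, hs, m, hm, rfl⟩, s * n,
    DomVia.of_left (by rw [e', e']) (by rw [e']; exact h.sa_mem) hZ hZ⟩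
  exact eq_of_src_eq h2 h1 D.src_src

theorem rng_eq_of_src_eq {D : T.DirectedCoset} (h : D.src = D) : D.rng = D := by
  have := D.rng_src
  rwa [h] at this

/-- `D` and `D^*` both have source `D`, so one common element `sb` suffices. -/
theorem dual_eq_of_src_eq {D : T.DirectedCoset} (h : D.src = D) : T.dual D.1 = D.1 := by
  have h1 : D.inv.src = D := by rw [src_inv, rng_eq_of_src_eq h]
  obtain ⟨a, ha⟩ := D.2.2.1
  obtain ⟨b, hb, s, hs, hd⟩ := D.exists_domVia ha
  have h2 : s * b ∈ D.1 := by
    have := D.dual_mul_subset_src ⟨s, hs, b, hb, rfl⟩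
    rwa [h] at this
  have h3 : s * b ∈ D.inv.1 := by
    have := D.inv.mul_src_subset
    rw [h1] at this
    exact this ⟨s, hs, b, hb, rfl⟩
  exact congrArg Subtype.val (eq_of_src_eq h3 h2 (h1.trans h.symm))

theorem mul_subset_of_src_eq {D : T.DirectedCoset} (h : D.src = D) : D.1 * D.1 ⊆ D.1 := by
  have := D.mul_src_subset
  rwa [h] at this

/-- A unit containing `sb`, where `b <ₛ a`, is the source of some directed coset containing
`a`. -/
theorem exists_src_eq {a s b : S} (h : T.DomVia b s a) {E : T.DirectedCoset}
    (hE : s * b ∈ E.1) : ∃ F : T.DirectedCoset, a ∈ F.1 ∧ F.src = E := by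
  have hu : E.src = E := E.src_eq_of_mem_N h.sa_mem hE
  have hmul := mul_subset_of_src_eq hu
  -- `sa` acts as a left identity below `sb`, so `w ↦ aw` can be undone there by `s`; this lets
  -- directedness pass from `E` to `aE`.
  have fix : ∀ w, T.Dom w (s * b) → s * a * w = w := by
    rintro w ⟨r, hr⟩
    have e : s * a * (s * b) = s * b := by
      rw [show s * a * (s * b) = s * (a * s * b) by simp only [mul_assoc], h.right]
    calc s * a * w = s * a * (s * b * r * w) := by rw [hr.right]
      _ = s * a * (s * b) * r * w := by simp only [mul_assoc]
      _ = w := by rw [e, hr.right]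
  have key : ∀ {w x}, T.Dom w (s * b) → T.Dom w x → T.Dom (a * w) (a * x) := by
    rintro w x hw ⟨t, ht⟩
    exact ⟨_, DomVia.mul_left_of_fix h.bs_mem h.sb_mem (fix w hw) ht⟩
  have hdir : T.IsDirected ({a} * E.1) := by
    rw [Set.singleton_mul]
    rintro _ ⟨x, hx, rfl⟩ _ ⟨y, hy, rfl⟩
    obtain ⟨z, hz, h1, h2⟩ := E.directed x hx y hy
    obtain ⟨w, hw, h3, h4⟩ := E.directed z hz _ hE
    exact ⟨a * w, ⟨w, hw, rfl⟩, key h4 (h3.trans h1), key h4 (h3.trans h2)⟩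
  -- Since `sbs` is dominated by `s` via `a`, the element `a` is itself a dual; the product of duals
  -- is then a dual of `sbs·aE = sb·E ⊆ E`.
  have hdual : T.dual ({a} * E.1) * {a} ⊆ E.1 := by
    have h1 : ({a} : Set S) ⊆ T.dual {s * b * s} := by
      rintro _ rfl
      exact ⟨_, rfl, s, h.reverse⟩
    calc T.dual ({a} * E.1) * {a} ⊆ T.dual ({a} * E.1) * T.dual {s * b * s} :=
          Set.mul_subset_mul_left h1
      _ ⊆ T.dual ({s * b * s} * ({a} * E.1)) := dual_mul_dual _ _
      _ ⊆ T.dual E.1 := by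
          refine dual_mono ?_
          rw [← mul_assoc, Set.singleton_mul_singleton, mul_assoc (s * b), mul_assoc s b,
            ← mul_assoc b s a, h.left]
          exact (Set.mul_subset_mul_right (Set.singleton_subset_iff.2 hE)).trans hmul
      _ = E.1 := dual_eq_of_src_eq hu
  have htriple : {a} * E.1 * T.dual ({a} * E.1) * ({a} * E.1) ⊆ {a} * E.1 := by
    calc {a} * E.1 * T.dual ({a} * E.1) * ({a} * E.1)
        = {a} * (E.1 * (T.dual ({a} * E.1) * {a}) * E.1) := by simp only [mul_assoc]
      _ ⊆ {a} * (E.1 * E.1 * E.1) := Set.mul_subset_mul_left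
          (Set.mul_subset_mul_right (Set.mul_subset_mul_left hdual))
      _ ⊆ {a} * E.1 := Set.mul_subset_mul_left ((Set.mul_subset_mul_right hmul).trans hmul)
  have hb : b ∈ ({a} * E.1 : Set S) := ⟨a, rfl, s * b, hE, by
    change a * (s * b) = b
    rw [← mul_assoc, h.right]⟩
  let F : T.DirectedCoset := ⟨T.up ({a} * E.1), isCoset_up htriple hdir,
    ⟨a, b, hb, s, h⟩, hdir.up⟩
  refine ⟨F, ⟨b, hb, s, h⟩, Subtype.ext (Set.Subset.antisymm ?_ ?_)⟩
  · rw [src_val]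
    refine (up_mono ((Set.mul_subset_mul_right (dual_up _)).trans (up_mul_up _ _))).trans
      ((up_up _).trans ((up_mono ?_).trans E.up_eq.le))
    rw [← mul_assoc]
    exact (Set.mul_subset_mul_right hdual).trans hmul
  · intro x hx
    obtain ⟨w, hw, h1, h2⟩ := E.directed x hx _ hE
    refine ⟨w, ⟨s, ⟨b, hdir.round hb, a, h⟩, a * w, hdir.round ⟨a, rfl, w, hw, rfl⟩, ?_⟩, h1⟩
    change s * (a * w) = w
    rw [← mul_assoc, fix w h2]

/-- A unit containing `bs`, where `b <ₛ a`, is the range of some directed coset containing `a`. -/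
theorem exists_rng_eq {a s b : S} (h : T.DomVia b s a) {E : T.DirectedCoset}
    (hE : b * s ∈ E.1) : ∃ F : T.DirectedCoset, a ∈ F.1 ∧ F.rng = E := by
  -- Build a coset through `s` with source `E` and invert it: it contains `sbs`, which is dominated
  -- via `a`.
  obtain ⟨F, hF, rfl⟩ := exists_src_eq h.reverse (E := E) (by rwa [h.mul_reverse])
  refine ⟨F.inv, ⟨s * b * s, ?_, s, h.reverse⟩, F.rng_inv⟩
  rw [mul_assoc]
  exact F.mul_src_subset ⟨s, hF, b * s, hE, rfl⟩

end DirectedCoset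

/-! ### Topology of the coset groupoid. -/

theorem isTopologicalBasis_directedCosetRep :
    TopologicalSpace.IsTopologicalBasis (Set.range T.directedCosetRep) where
  exists_subset_inter := by
    rintro _ ⟨a, rfl⟩ _ ⟨b, rfl⟩ D ⟨ha, hb⟩
    obtain ⟨d, hd, h1, h2⟩ := D.directed a ha b hb
    exact ⟨_, ⟨d, rfl⟩, hd, fun E hE => ⟨E.mem_of_dom hE h1, E.mem_of_dom hE h2⟩⟩
  sUnion_eq := by
    refine Set.eq_univ_of_forall fun D => ?_
    obtain ⟨a, ha⟩ := D.2.2.1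
    exact ⟨_, ⟨a, rfl⟩, ha⟩
  eq_generateFrom := rfl

theorem isOpen_directedCosetRep (a : S) : IsOpen (T.directedCosetRep a) :=
  isTopologicalBasis_directedCosetRep.isOpen ⟨a, rfl⟩

/-- Membership of `a` in `D^*` is witnessed by a single element of `D`, and in `DE^<` by one element
from each factor, so it persists on a basic neighbourhood. Openness of the source is
`exists_src_eq`. -/
theorem isEtale_directedCoset : ArrowGroupoid.IsEtale T.DirectedCoset where
  continuous_inv := by
    refine continuous_generateFrom_iff.2 ?_
    rintro _ ⟨a, rfl⟩
    refine isOpen_iff_forall_mem_open.2 ?_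
    rintro D ⟨x, hx, b, h⟩
    exact ⟨_, fun E hE => ⟨x, hE, b, h⟩, isOpen_directedCosetRep x, hx⟩
  continuous_mul := by
    refine continuous_generateFrom_iff.2 ?_
    rintro _ ⟨a, rfl⟩
    refine isOpen_iff_forall_mem_open.2 ?_
    rintro ⟨⟨D, E⟩, p⟩ ⟨_, ⟨x, hx, y, hy, rfl⟩, h⟩
    refine ⟨Subtype.val ⁻¹' (T.directedCosetRep x ×ˢ T.directedCosetRep y), ?_,
      ((isOpen_directedCosetRep x).prod (isOpen_directedCosetRep y)).preimage
        continuous_subtype_val, ⟨hx, hy⟩⟩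
    rintro ⟨⟨D', E'⟩, p'⟩ ⟨hx', hy'⟩
    exact ⟨x * y, ⟨x, hx', y, hy', rfl⟩, h⟩
  isOpenMap_src := by
    refine isTopologicalBasis_directedCosetRep.isOpenMap_iff.2 ?_
    rintro _ ⟨a, rfl⟩
    refine isOpen_iff_forall_mem_open.2 ?_
    rintro _ ⟨D, hD, rfl⟩
    obtain ⟨b, hb, s, hs, h⟩ := D.exists_domVia hD
    refine ⟨_, fun E hE => ?_, isOpen_directedCosetRep (s * b),
      D.dual_mul_subset_src ⟨s, hs, b, hb, rfl⟩⟩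
    obtain ⟨F, hF, e⟩ := DirectedCoset.exists_src_eq h hE
    exact ⟨F, hF, e⟩

/-! ### Symmetry of `Z` and multiplicativity of the coset representation. -/

/-- For symmetric `Z`, if `c` is dominated by `ab` via `t` then `btc` is dominated by `b`. -/
theorem DomVia.right_factor (hZ : IsSymmetricSubset (T.Z : Set S)) {a b c t : S}
    (h : T.DomVia c t (a * b)) : T.DomVia (b * t * c) (t * a * b * t * a) b := by
  have e : t * a * b * t * a * (b * t * c) = t * c := by
    calc t * a * b * t * a * (b * t * c) = t * (a * b * t * (a * b * t * c)) := by
          simp only [mul_assoc]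
      _ = t * c := by rw [h.right, h.right]
  refine DomVia.of_right ?_ (by rw [e]; exact h.sa_mem) ?_ ?_
  · rw [mul_assoc b, e, mul_assoc]
  -- This is why the witness is `tabta` and not `ta`: symmetry puts only the square of `bta` in `Z`.
  · have := hZ (t * a) b (by simpa only [mul_assoc, SetLike.mem_coe] using h.sb_mem)
    simpa only [mul_assoc, SetLike.mem_coe] using this
  · have := T.Z.mul_mem h.sb_mem h.sb_mem
    simpa only [mul_assoc] using this

/-- For symmetric `Z`, if `c` is dominated by `ab` via `t` then `cta` is dominated by `a`. -/
theorem DomVia.left_factor (hZ : IsSymmetricSubset (T.Z : Set S)) {a b c t : S}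
    (h : T.DomVia c t (a * b)) : T.DomVia (c * t * a) (b * t * a * b * t) a := by
  have e : c * t * a * (b * t * a * b * t) = c * t := by
    calc c * t * a * (b * t * a * b * t) = c * t * (a * b) * t * (a * b) * t := by
          simp only [mul_assoc]
      _ = c * t := by rw [h.left, h.left]
  refine DomVia.of_left (by rw [e]) (by rw [e]; exact h.as_mem) ?_ ?_
  · have := T.Z.mul_mem h.bs_mem h.bs_mem
    simpa only [mul_assoc] using this
  · have := hZ a (b * t) (by simpa only [mul_assoc, SetLike.mem_coe] using h.bs_mem)
    simpa only [mul_assoc, SetLike.mem_coe] using this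

theorem directedCosetRep_mul (hZ : IsSymmetricSubset (T.Z : Set S)) (a b : S) :
    T.directedCosetRep (a * b) =
      ArrowGroupoid.setMul (T.directedCosetRep a) (T.directedCosetRep b) := by
  apply Set.Subset.antisymm
  · intro D hD
    obtain ⟨c, hc, t, ht, h⟩ := D.exists_domVia hD
    have hr := h.right_factor hZ
    have e : t * a * b * t * a * (b * t * c) = t * c := by
      calc t * a * b * t * a * (b * t * c) = t * (a * b * t * (a * b * t * c)) := by
            simp only [mul_assoc]
        _ = t * c := by rw [h.right, h.right]
    have htc : t * c ∈ D.src.1 := D.dual_mul_subset_src ⟨t, ht, c, hc, rfl⟩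
    -- The right factor is a coset `E` through `b` with the source of `D`; the left factor is then
    -- forced to be `D·E⁻¹`, which contains `cta < a`.
    obtain ⟨E, hE, hs⟩ := DirectedCoset.exists_src_eq hr (E := D.src) (by rwa [e])
    have p : ArrowGroupoid.src D = ArrowGroupoid.rng (ArrowGroupoid.inv E) := by
      rw [ArrowGroupoid.rng_inv]
      exact hs.symm
    refine ⟨ArrowGroupoid.mul D (ArrowGroupoid.inv E) p, ?_, E, hE, ?_, ?_⟩
    · refine ⟨c * t * a, ⟨c, hc, t * a * b * t * a, ⟨b * t * c, ?_, b, hr⟩, ?_⟩,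
        _, h.left_factor hZ⟩
      · rw [mul_assoc]
        exact E.mul_src_subset ⟨b, hE, t * c, by rwa [hs], rfl⟩
      · calc c * (t * a * b * t * a) = c * t * (a * b) * t * a := by simp only [mul_assoc]
          _ = c * t * a := by rw [h.left]
    · rw [ArrowGroupoid.src_mul, ArrowGroupoid.src_inv]
    · rw [ArrowGroupoid.mul_assoc _ _ _ p (ArrowGroupoid.src_inv E)]
      refine (ArrowGroupoid.mul_eq_left _ ?_).symm
      rw [ArrowGroupoid.inv_mul, ArrowGroupoid.rng_src]
  · rintro _ ⟨D, hD, E, hE, p, rfl⟩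
    exact (D.directed.mul E.directed).round ⟨a, hD, b, hE, rfl⟩

theorem isEtaleRepresentation_directedCosetRep (hZ : IsSymmetricSubset (T.Z : Set S)) :
    T.IsEtaleRepresentation T.directedCosetRep where
  etale := isEtale_directedCoset
  isOpen := isOpen_directedCosetRep
  isSlice _ := ⟨fun _ hD _ hE h => DirectedCoset.eq_of_src_eq hD hE h,
    fun _ hD _ hE h => DirectedCoset.eq_of_rng_eq hD hE h⟩
  map_mul := directedCosetRep_mul hZ
  covers D := D.2.2.1
  map_N _ hn D hD := ArrowGroupoid.mem_units_of_src (D.src_eq_of_mem_N hn hD)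
  locally_round D a ha := by
    obtain ⟨b, hb, s, -, h⟩ := D.exists_domVia ha
    exact ⟨b, ⟨s, h⟩, hb⟩

/-! ### Fibres of an étale representation. -/

/-- The elements of `S` represented at `h`. -/
def fiber {H : Type v} (θ : S → Set H) (h : H) : Set S := {a | h ∈ θ a}

namespace IsEtaleRepresentation

variable {H : Type v} [ArrowGroupoid H] [TopologicalSpace H] {θ : S → Set H}

open ArrowGroupoid hiding mul_assoc mul_inv

theorem mul_mem_fiber (hθ : T.IsEtaleRepresentation θ) {g h : H} (p : src g = rng h) {a b : S}
    (ha : a ∈ fiber θ g) (hb : b ∈ fiber θ h) : a * b ∈ fiber θ (mul g h p) := by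
  change _ ∈ θ (a * b)
  rw [hθ.map_mul]
  exact ⟨g, ha, h, hb, p, rfl⟩

/-- Factor `h` through `θ(as)θ(b)`: the first factor is a unit, so `h ∈ θ(b)`. Factoring that unit
through `θ(a)θ(s)` gives `y ∈ θ(s)` with `yh ∈ θ(sb)`, again a unit, whence `y = h⁻¹`. -/
theorem mem_fiber_of_domVia (hθ : T.IsEtaleRepresentation θ) {h : H} {a s b : S}
    (hd : T.DomVia a s b) (ha : a ∈ fiber θ h) : b ∈ fiber θ h ∧ s ∈ fiber θ (inv h) := by
  change h ∈ θ a at ha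
  rw [← hd.left, hθ.map_mul] at ha
  obtain ⟨k, hk, z, hz, p, e⟩ := ha
  rw [mul_eq_right p (src_of_mem_units (hθ.map_N _ hd.as_mem hk))] at e
  subst e
  refine ⟨hz, ?_⟩
  rw [hθ.map_mul] at hk
  obtain ⟨x, -, y, hy, q, rfl⟩ := hk
  rw [src_mul] at p
  have := hθ.map_N _ (T.Z_le_N hd.sb_mem) ((hθ.map_mul s b).ge ⟨y, hy, h, hz, p, rfl⟩)
  rwa [eq_inv_of_mul_mem_units p this] at hy

theorem mem_fiber_of_dom (hθ : T.IsEtaleRepresentation θ) {h : H} {a b : S} (hd : T.Dom a b)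
    (ha : a ∈ fiber θ h) : b ∈ fiber θ h := by
  obtain ⟨s, hs⟩ := hd
  exact (hθ.mem_fiber_of_domVia hs ha).1

theorem up_fiber_subset (hθ : T.IsEtaleRepresentation θ) (h : H) :
    T.up (fiber θ h) ⊆ fiber θ h := fun _ ⟨_, ha, hd⟩ => hθ.mem_fiber_of_dom hd ha

theorem dual_fiber_subset (hθ : T.IsEtaleRepresentation θ) (h : H) :
    T.dual (fiber θ h) ⊆ fiber θ (inv h) := fun _ ⟨_, ha, _, hd⟩ => (hθ.mem_fiber_of_domVia hd ha).2

theorem up_mul_subset_fiber (hθ : T.IsEtaleRepresentation θ) {g h : H} (p : src g = rng h)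
    {A B : Set S} (hA : A ⊆ fiber θ g) (hB : B ⊆ fiber θ h) :
    T.up (A * B) ⊆ fiber θ (mul g h p) := by
  refine (up_mono ?_).trans (hθ.up_fiber_subset _)
  rintro _ ⟨a, ha, b, hb, rfl⟩
  exact hθ.mul_mem_fiber p (hA ha) (hB hb)

theorem inv_subset_fiber (hθ : T.IsEtaleRepresentation θ) {D : T.DirectedCoset} {h : H}
    (hD : D.1 ⊆ fiber θ h) : D.inv.1 ⊆ fiber θ (inv h) :=
  (dual_mono hD).trans (hθ.dual_fiber_subset h)

theorem rng_subset_fiber (hθ : T.IsEtaleRepresentation θ) {D : T.DirectedCoset} {h : H}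
    (hD : D.1 ⊆ fiber θ h) : D.rng.1 ⊆ fiber θ (rng h) := by
  have := hθ.up_mul_subset_fiber (rng_inv h).symm hD (hθ.inv_subset_fiber hD)
  rwa [ArrowGroupoid.mul_inv] at this

theorem src_subset_fiber (hθ : T.IsEtaleRepresentation θ) {D : T.DirectedCoset} {h : H}
    (hD : D.1 ⊆ fiber θ h) : D.src.1 ⊆ fiber θ (src h) := by
  have := hθ.up_mul_subset_fiber (src_inv h) (hθ.inv_subset_fiber hD) hD
  rwa [inv_mul] at this

/-! ### The unit coset of a unit of `H`. -/

theorem mul_mem_fiber_of_mem_units (hθ : T.IsEtaleRepresentation θ) {u : H} (hu : u ∈ units H)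
    {a b : S} (ha : a ∈ fiber θ u) (hb : b ∈ fiber θ u) : a * b ∈ fiber θ u := by
  have := hθ.mul_mem_fiber hu.1 ha hb
  rwa [mul_eq_right _ (src_of_mem_units hu)] at this

theorem mem_fiber_rng_src (hθ : T.IsEtaleRepresentation θ) {h : H} {a s b : S}
    (hd : T.DomVia a s b) (ha : a ∈ fiber θ h) :
    a * s ∈ fiber θ (rng h) ∧ s * a ∈ fiber θ (src h) := by
  have hs := (hθ.mem_fiber_of_domVia hd ha).2
  have h1 := hθ.mul_mem_fiber (rng_inv h).symm ha hs
  have h2 := hθ.mul_mem_fiber (src_inv h) hs ha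
  rw [ArrowGroupoid.mul_inv] at h1
  rw [inv_mul] at h2
  exact ⟨h1, h2⟩

theorem exists_domVia (hθ : T.IsEtaleRepresentation θ) {h : H} {a : S} (ha : a ∈ fiber θ h) :
    ∃ b ∈ fiber θ h, ∃ s, T.DomVia b s a := by
  obtain ⟨b, ⟨s, hs⟩, hb⟩ := hθ.locally_round h a ha
  exact ⟨b, hb, s, hs⟩

/-- Multiplying by elements of `N` preserves domination, so with `n' < n` and `m' < m` the product
`n'm'` lies below both. -/
theorem isDirected_fiber_inter_N (hθ : T.IsEtaleRepresentation θ) {u : H} (hu : u ∈ units H) :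
    T.IsDirected (fiber θ u ∩ T.N) := by
  rintro n ⟨hn, hnN⟩ m ⟨hm, hmN⟩
  obtain ⟨n', hn', s, hs⟩ := hθ.exists_domVia hn
  obtain ⟨m', hm', t, ht⟩ := hθ.exists_domVia hm
  have h1 := hs.mul_mem_N hnN
  have h2 := ht.mul_mem_N hmN
  exact ⟨n' * m', ⟨hθ.mul_mem_fiber_of_mem_units hu hn' hm', T.N.mul_mem h1 h2⟩,
    ⟨s, hs.smul_right h2⟩, ⟨t, ht.smul_left h1⟩⟩

theorem fiber_inter_N_nonempty (hθ : T.IsEtaleRepresentation θ) {u : H} (hu : u ∈ units H) :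
    (fiber θ u ∩ T.N).Nonempty := by
  obtain ⟨a, ha⟩ := hθ.covers u
  obtain ⟨b, hb, s, hs⟩ := hθ.exists_domVia (h := u) ha
  have := (hθ.mem_fiber_rng_src hs hb).1
  rw [rng_of_mem_units hu] at this
  exact ⟨b * s, this, hs.as_mem⟩

theorem dual_fiber_inter_N_subset (hθ : T.IsEtaleRepresentation θ) {u : H} (hu : u ∈ units H) :
    T.dual (fiber θ u ∩ T.N) ⊆ T.up (fiber θ u ∩ T.N) := by
  rintro t ⟨a, ⟨ha, haN⟩, b, h⟩
  have h1 := (hθ.mem_fiber_rng_src h ha).1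
  rw [rng_of_mem_units hu] at h1
  refine ⟨a * a * t, ⟨?_, ?_⟩, b, DomVia.switch (T.N.mul_mem haN haN) h⟩
  · rw [mul_assoc]
    exact hθ.mul_mem_fiber_of_mem_units hu ha h1
  · rw [mul_assoc]
    exact T.N.mul_mem haN h.as_mem

/-- The unit directed coset `(θ_u ∩ N)^<` attached to a unit `u`. -/
def unitCoset (hθ : T.IsEtaleRepresentation θ) {u : H} (hu : u ∈ units H) : T.DirectedCoset :=
  have hd := hθ.isDirected_fiber_inter_N hu
  have hdual : T.dual (T.up (fiber θ u ∩ T.N)) ⊆ T.up (fiber θ u ∩ T.N) :=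
    (dual_up _).trans ((up_mono (hθ.dual_fiber_inter_N_subset hu)).trans (up_up _))
  have hmul : T.up (fiber θ u ∩ T.N) * T.up (fiber θ u ∩ T.N) ⊆ T.up (fiber θ u ∩ T.N) := by
    refine (up_mul_up _ _).trans (up_mono ?_)
    rintro _ ⟨a, ha, b, hb, rfl⟩
    exact ⟨hθ.mul_mem_fiber_of_mem_units hu ha.1 hb.1, T.N.mul_mem ha.2 hb.2⟩
  ⟨T.up (fiber θ u ∩ T.N),
    ⟨(Set.mul_subset_mul_right ((Set.mul_subset_mul_left hdual).trans hmul)).trans hmul,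
      Set.Subset.antisymm hd.up.round (up_up _)⟩,
    (hθ.fiber_inter_N_nonempty hu).mono hd.round, hd.up⟩

theorem inter_N_subset_unitCoset (hθ : T.IsEtaleRepresentation θ) {u : H} (hu : u ∈ units H) :
    fiber θ u ∩ T.N ⊆ (hθ.unitCoset hu).1 := (hθ.isDirected_fiber_inter_N hu).round

theorem unitCoset_subset_fiber (hθ : T.IsEtaleRepresentation θ) {u : H} (hu : u ∈ units H) :
    (hθ.unitCoset hu).1 ⊆ fiber θ u :=
  (up_mono Set.inter_subset_left).trans (hθ.up_fiber_subset u)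

theorem unitCoset_subset (hθ : T.IsEtaleRepresentation θ) {u : H} (hu : u ∈ units H)
    {D : T.DirectedCoset} (h : fiber θ u ∩ T.N ⊆ D.1) : (hθ.unitCoset hu).1 ⊆ D.1 :=
  (up_mono h).trans D.up_eq.le

/-- Maximality of the unit coset: a unit coset `V` contains some `sw ∈ N`, and everything below `sw`
is in `N`, so by directedness `V` is generated by `V ∩ N`. -/
theorem subset_unitCoset (hθ : T.IsEtaleRepresentation θ) {u : H} (hu : u ∈ units H)
    {V : T.DirectedCoset} (hV : V.src = V) (h : V.1 ⊆ fiber θ u) : V.1 ⊆ (hθ.unitCoset hu).1 := by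
  intro v hv
  obtain ⟨w, hw, s, hs, hd⟩ := V.exists_domVia hv
  have hsw : s * w ∈ V.1 := by
    have := V.dual_mul_subset_src ⟨s, hs, w, hw, rfl⟩
    rwa [hV] at this
  obtain ⟨d, hdV, h1, h2⟩ := V.directed v hv _ hsw
  exact ⟨d, ⟨h hdV, h2.mem_N hd.sa_mem⟩, h1⟩

/-! ### The universal morphism and its uniqueness. -/

/-- The unit directed coset at the source of `h`. -/
abbrev srcCoset (hθ : T.IsEtaleRepresentation θ) (h : H) : T.DirectedCoset :=
  hθ.unitCoset (src_mem_units h)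

/-- The unit directed coset at the range of `h`. -/
abbrev rngCoset (hθ : T.IsEtaleRepresentation θ) (h : H) : T.DirectedCoset :=
  hθ.unitCoset (rng_mem_units h)

theorem unitCoset_congr (hθ : T.IsEtaleRepresentation θ) {u w : H} (hu : u ∈ units H)
    (hw : w ∈ units H) (e : u = w) : hθ.unitCoset hu = hθ.unitCoset hw := by
  subst e
  rfl

/-- Compare `D` with a coset `F` through the same `a` having the desired range. Maximality gives
`s(F) ⊆ s(D)`, hence `F ⊆ D` and `r(F) ⊆ r(D)`; maximality at the range gives the reverse inclusion.
-/
theorem rng_eq_of_src_eq (hθ : T.IsEtaleRepresentation θ) {D : T.DirectedCoset} {h : H}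
    (hD : D.1 ⊆ fiber θ h) (hs : D.src = hθ.srcCoset h) : D.rng = hθ.rngCoset h := by
  obtain ⟨a, ha⟩ := D.2.2.1
  obtain ⟨b, hb, s, hd⟩ := hθ.exists_domVia (hD ha)
  obtain ⟨F, hF, hr⟩ := DirectedCoset.exists_rng_eq hd (E := hθ.rngCoset h)
    (hθ.inter_N_subset_unitCoset _ ⟨(hθ.mem_fiber_rng_src hd hb).1, hd.as_mem⟩)
  have hFh : F.1 ⊆ fiber θ h := by
    rw [F.eq_up_rng_mul hF, hr]
    have := hθ.up_mul_subset_fiber (src_rng h) (hθ.unitCoset_subset_fiber (rng_mem_units h))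
      (Set.singleton_subset_iff.2 (hD ha))
    rwa [rng_mul_self] at this
  have hsub : F.1 ⊆ D.1 := by
    rw [F.eq_up_mul_src hF, D.eq_up_mul_src ha, hs]
    exact up_mono (Set.mul_subset_mul_left
      (hθ.subset_unitCoset (src_mem_units h) F.src_src (hθ.src_subset_fiber hFh)))
  apply Subtype.ext
  apply Set.Subset.antisymm
  · exact hθ.subset_unitCoset _ D.src_rng (hθ.rng_subset_fiber hD)
  · rw [← hr]
    exact up_mono (Set.mul_subset_mul hsub (dual_mono hsub))

theorem src_eq_of_rng_eq (hθ : T.IsEtaleRepresentation θ) {D : T.DirectedCoset} {h : H}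
    (hD : D.1 ⊆ fiber θ h) (hr : D.rng = hθ.rngCoset h) : D.src = hθ.srcCoset h := by
  have h1 : D.inv.rng = _ := hθ.rng_eq_of_src_eq (hθ.inv_subset_fiber hD)
    (by rw [D.src_inv, hr]; exact hθ.unitCoset_congr _ _ (src_inv h).symm)
  rw [D.rng_inv] at h1
  rw [h1]
  exact hθ.unitCoset_congr _ _ (rng_inv h)

/-- The Zakrzewski morphism from `H` to the directed cosets defined by a representation on `H`. -/
def morphism (hθ : T.IsEtaleRepresentation θ) : Set (T.DirectedCoset × H) :=
  {x | x.1.1 ⊆ fiber θ x.2 ∧ x.1.src = hθ.srcCoset x.2 ∧ x.1.rng = hθ.rngCoset x.2}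

theorem relPreimage_morphism (hθ : T.IsEtaleRepresentation θ) (a : S) :
    relPreimage hθ.morphism (T.directedCosetRep a) = θ a := by
  apply Set.Subset.antisymm
  · rintro h ⟨D, hD, hDh, -⟩
    exact hDh hD
  · intro h ha
    obtain ⟨b, hb, s, hd⟩ := hθ.exists_domVia (h := h) ha
    -- The coset related to `h` is `(a·V_{s(h)})^<`.
    obtain ⟨F, hF, hs⟩ := DirectedCoset.exists_src_eq hd (E := hθ.srcCoset h)
      (hθ.inter_N_subset_unitCoset _ ⟨(hθ.mem_fiber_rng_src hd hb).2, hd.sa_mem⟩)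
    have hFh : F.1 ⊆ fiber θ h := by
      rw [F.eq_up_mul_src hF, hs]
      have := hθ.up_mul_subset_fiber (rng_src h).symm (Set.singleton_subset_iff.2 ha)
        (hθ.unitCoset_subset_fiber (src_mem_units h))
      rwa [mul_src] at this
    exact ⟨F, hF, hFh, hs, hθ.rng_eq_of_src_eq hFh hs⟩

theorem isZakrzewskiMorphism_morphism (hθ : T.IsEtaleRepresentation θ) :
    IsZakrzewskiMorphism hθ.morphism where
  functorial :=
    { inv_mem := by
        rintro D h ⟨h1, h2, h3⟩
        exact ⟨hθ.inv_subset_fiber h1,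
          D.src_inv.trans (h3.trans (hθ.unitCoset_congr _ _ (src_inv h).symm)),
          D.rng_inv.trans (h2.trans (hθ.unitCoset_congr _ _ (rng_inv h).symm))⟩
      mul_mem := by
        rintro D h E k ⟨h1, h2, h3⟩ ⟨k1, k2, k3⟩ q
        exact ⟨h2.trans ((hθ.unitCoset_congr _ _ q).trans k3.symm),
          hθ.up_mul_subset_fiber q h1 k1,
          (src_mul _ _ _).trans (k2.trans (hθ.unitCoset_congr _ _ (src_mul h k q).symm)),
          (rng_mul _ _ _).trans (h3.trans (hθ.unitCoset_congr _ _ (rng_mul h k q).symm))⟩ }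
  star_bijective := by
    rintro D u hu ⟨h1, -, h3⟩
    obtain ⟨a, ha⟩ := D.2.2.1
    obtain ⟨b, hb, s, hs, hd⟩ := D.exists_domVia ha
    -- The arrow over `u` is the `θ(b)`-factor of `u ∈ θ(b)θ(s)`; it is unique because `θ(b)` is a
    -- slice.
    have hbs : u ∈ θ (b * s) := h1 (D.mul_dual_subset_rng ⟨b, hb, s, hs, rfl⟩)
    rw [hθ.map_mul] at hbs
    obtain ⟨i, hi, j, -, p, e⟩ := hbs
    have hr : rng i = u := by
      rw [← rng_mul i j p, ← e, rng_of_mem_units hu]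
    have hDi : D.1 ⊆ fiber θ i := by
      rw [D.eq_up_rng_mul hb]
      have := hθ.up_mul_subset_fiber (src_rng i) (A := D.rng.1) (by rw [hr]; exact h1)
        (Set.singleton_subset_iff.2 hi)
      rwa [rng_mul_self] at this
    have hDr : D.rng = hθ.rngCoset i :=
      (rng_rng D).symm.trans (h3.trans
        (hθ.unitCoset_congr _ _ (by rw [rng_of_mem_units hu, hr])))
    refine ⟨i, ⟨hr, hDi, hθ.src_eq_of_rng_eq hDi hDr, hDr⟩, ?_⟩
    rintro k ⟨hk, hDk, -⟩
    exact (hθ.isSlice b).2 (hDk hb) hi (hk.trans hr.symm)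
  continuous O hO := by
    refine isOpen_iff_forall_mem_open.2 ?_
    rintro h ⟨D, hD, hDh⟩
    obtain ⟨_, ⟨a, rfl⟩, ha, hsub⟩ :=
      isTopologicalBasis_directedCosetRep.exists_subset_of_mem_open hD hO
    refine ⟨θ a, ?_, hθ.isOpen a, hDh.1 ha⟩
    rw [← hθ.relPreimage_morphism]
    rintro k ⟨E, hE, hk⟩
    exact ⟨E, hsub hE, hk⟩

/-- The crux is `hunit`. If `n ∈ θ_u ∩ N`, some `E` containing `n` is related to `u`; functoriality
makes `EV` defined, and two composable units are equal, so `n ∈ V`. -/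
theorem eq_morphism (hθ : T.IsEtaleRepresentation θ) {φ : Set (T.DirectedCoset × H)}
    (hφ : IsZakrzewskiMorphism φ) (h : ∀ a, θ a = relPreimage φ (T.directedCosetRep a)) :
    φ = hθ.morphism := by
  have hsub : ∀ {D k}, (D, k) ∈ φ → D.1 ⊆ fiber θ k := by
    intro D k hD a ha
    change k ∈ θ a
    rw [h]
    exact ⟨D, ha, hD⟩
  have hunit : ∀ {V : T.DirectedCoset} {u : H} (hu : u ∈ units H), V.src = V → (V, u) ∈ φ →
      V = hθ.unitCoset hu := by
    intro V u hu hV hVu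
    refine Subtype.ext (Set.Subset.antisymm (hθ.subset_unitCoset hu hV (hsub hVu))
      (hθ.unitCoset_subset hu ?_))
    rintro n ⟨hn, hnN⟩
    change u ∈ θ n at hn
    rw [h] at hn
    obtain ⟨E, hE, hEu⟩ := hn
    obtain ⟨p, -⟩ := hφ.functorial.mul_mem _ _ _ _ hEu hVu hu.1
    have e : E = V := (E.src_eq_of_mem_N hnN hE).symm.trans
      (p.trans (DirectedCoset.rng_eq_of_src_eq hV))
    rwa [← e]
  have hle : φ ⊆ hθ.morphism := by
    rintro ⟨D, k⟩ hD
    have hi := hφ.functorial.inv_mem _ _ hD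
    obtain ⟨p, hs⟩ := hφ.functorial.mul_mem _ _ _ _ hi hD (src_inv k)
    obtain ⟨q, hr⟩ := hφ.functorial.mul_mem _ _ _ _ hD hi (rng_inv k).symm
    rw [inv_mul, inv_mul] at hs
    rw [ArrowGroupoid.mul_inv, ArrowGroupoid.mul_inv] at hr
    exact ⟨hsub hD, hunit _ D.src_src hs, hunit _ D.src_rng hr⟩
  refine Set.Subset.antisymm hle ?_
  rintro ⟨D, k⟩ hD
  obtain ⟨a, ha⟩ := D.2.2.1
  have hk : k ∈ θ a := hD.1 ha
  rw [h] at hk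
  obtain ⟨E, hE, hEk⟩ := hk
  -- `D` and `E` share `a` and both have source `V_{s(k)}`.
  rwa [DirectedCoset.eq_of_src_eq ha hE (hD.2.1.trans (hle hEk).2.1.symm)]

end IsEtaleRepresentation

end StructuredSemigroup

theorem theorem11p15 {S : Type u} [Semigroup S] (T : StructuredSemigroup S)
    (hZ : IsSymmetricSubset (T.Z : Set S)) :
    StructuredSemigroup.IsZakrzewskiUniversal.{u, v} T T.directedCosetRep :=
  ⟨StructuredSemigroup.isEtaleRepresentation_directedCosetRep hZ, fun _ _ _ _ hθ =>
    ⟨hθ.morphism, ⟨hθ.isZakrzewskiMorphism_morphism, fun a => (hθ.relPreimage_morphism a).symm⟩,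
      fun _ hφ => hθ.eq_morphism hφ.1 hφ.2⟩⟩
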